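/- **Lemma 2.1.** Let $X$ be a complex Hilbert space and let $\mathcal A,\mathcal B,\mathcal C$ be (possibly unbounded) linear operators in $X$ with $\mathcal A,\mathcal C$ self-adjoint, $\mathcal B$ skew-symmetric ($\langle \mathcal Bu,v\rangle=-\langle u,\mathcal Bv\rangle$ for all $u,v\in D(\mathcal B)$), and $D(\mathcal A)\subseteq D(\mathcal B)\cap D(\mathcal C)$. Consider the quadratic pencil $$\mathcal P_2(\lambda)=\mathcal A+\lambda\mathcal B+\lambda^2\mathcal C,\qquad \lambda\in\mathbb C,$$ on $D(\mathcal A)\cap D(\mathcal B)\cap D(\mathcal C)=D(\mathcal A)$. Its spectrum is the set of all $\lambda\in\mathbb C$ at which $\mathcal P_2(\lambda)$ is not boundedly invertible, and its eigenvalues are the $\lambda$ with $\ker\mathcal P_2(\lambda)\neq\{0\}$. Suppose that $\ker(\mathcal A)$ is finite-dimensional, and let $P_{\mathcal A}^\perp$ be the orthogonal projection of $X$ onto $\ker(\mathcal A)^\perp$. Suppose that $P_{\mathcal A}^\perp\mathcal A P_{\mathcal A}^\perp:\ker(\mathcal A)^\perp\to\ker(\mathcal A)^\perp$ is boundedly invertible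 and that the operators $$(P_{\mathcal A}^\perp\mathcal A P_{\mathcal A}^\perp)^{-1}P_{\mathcal A}^\perp\mathcal B P_{\mathcal A}^\perp,\qquad (P_{\mathcal A}^\perp\mathcal A P_{\mathcal A}^\perp)^{-1}P_{\mathcal A}^\perp\mathcal C P_{\mathcal A}^\perp:\ \ker(\mathcal A)^\perp\to\ker(\mathcal A)^\perp$$ are both compact (that is, each extends from its domain to a compact operator on $\ker(\mathcal A)^\perp$). Suppose finally that at least one of the following holds: 1. $\mathrm n(\mathcal A)<\infty$, $\mathrm n(\mathcal C)<\infty$ and $\ker(\mathcal C)=\{0\}$, where $\mathrm n(\mathcal S)$ is the maximal dimension of a subspace of $D(\mathcal S)$ on which the form $\langle u,\mathcal Su\rangle$ is negative definite (when finite, this is the number of negative eigenvalues of the self-adjoint operator $\mathcal S$, counted with multiplicity); 2. at least one $\lambda\in\mathbb C$ is not an eigenvalue of $\mathcal P_2$. Then the spectrum of $\mathcal P_2$ is point spectrum only, i.e. it coincides with the set of eigenvalues. Each eigenvalue $\lambda$ has finite algebraic multiplicity, i.e. the sum of the partial multiplicities at $\lambda$ is finite: this sum is $\sum_{k\ge1}\dim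 L_k$, where $L_k$ is the space of all $u_0\in D(\mathcal A)$ for which there are $u_1,\dots,u_{k-1}\in D(\mathcal A)$ with $\sum_{j=0}^{i}\frac1{j!}\mathcal P_2^{(j)}(\lambda)u_{i-j}=0$ for $0\le i<k$. The set of eigenvalues has no accumulation point in $\mathbb C$, so eigenvalues can accumulate only at infinity. -/

import Mathlib

/-!
Unbounded operators on a complex Hilbert space `X` are partially defined linear maps
`X →ₗ.[ℂ] X`; self-adjointness is Mathlib's `IsSelfAdjoint` for such maps (`A† = A`, which forces
a dense domain).
-/

noncomputable section

namespace QuadPencil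

open scoped InnerProductSpace

variable {X : Type*} [NormedAddCommGroup X] [InnerProductSpace ℂ X]

/-- The kernel of an unbounded operator, as a subspace of the ambient space. -/
def kernel (T : X →ₗ.[ℂ] X) : Submodule ℂ X :=
  (LinearMap.ker T.toFun).map T.domain.subtype

/-- `⟪B u, v⟫ = -⟪u, B v⟫` on the domain of `B`. -/
def IsSkewSymmetric (B : X →ₗ.[ℂ] X) : Prop :=
  ∀ u v : B.domain, ⟪B u, (v : X)⟫_ℂ = -⟪(u : X), B v⟫_ℂ

/-- `n(S)`: the maximal dimension of a subspace of the domain of `S` on which the quadratic form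
`u ↦ ⟪u, S u⟫` is negative definite.  For a self-adjoint `S` it is finite exactly when the negative
part of the spectrum consists of finitely many eigenvalues of finite multiplicity, and it is then
the number of negative eigenvalues counted with multiplicity. -/
def negIndex (S : X →ₗ.[ℂ] X) : ℕ∞ :=
  ⨆ V : {V : Submodule ℂ S.domain // ∀ u ∈ V, u ≠ 0 → (⟪(u : X), S u⟫_ℂ).re < 0},
    Cardinal.toENat (Module.rank ℂ V.1)

/-- The compression `P T P` of an unbounded operator `T` to a subspace `K`, as an unbounded operator
in `K`; here `P` is the orthogonal projection onto `K`.  Its domain is `K ∩ dom T`. -/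
def compression (T : X →ₗ.[ℂ] X) (K : Submodule ℂ X) [K.HasOrthogonalProjection] :
    K →ₗ.[ℂ] K where
  domain := T.domain.comap K.subtype
  toFun := K.orthogonalProjectionOnto.toLinearMap ∘ₗ T.toFun ∘ₗ
    (K.subtype.comp (T.domain.comap K.subtype).subtype).codRestrict T.domain (fun u => u.2)

/-- The bounded operator `R` is the inverse of the unbounded operator `T`: it inverts the bijection
`T : dom T → X`. -/
def IsBoundedInverse (T : X →ₗ.[ℂ] X) (R : X →L[ℂ] X) : Prop :=
  (∀ u : T.domain, R (T u) = u) ∧ ∀ v : X, ∃ u : T.domain, (u : X) = R v ∧ T u = v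

/-- An operator is compact if it is the restriction to its domain of a compact bounded operator.
For an operator with dense domain this says that bounded sets are mapped to relatively compact
ones. -/
def IsCompactOp (T : X →ₗ.[ℂ] X) : Prop :=
  ∃ S : X →L[ℂ] X, IsCompactOperator S ∧ ∀ u : T.domain, S u = T u

/-- The common domain of the coefficients of the pencil. -/
def pencilDomain (A B C : X →ₗ.[ℂ] X) : Submodule ℂ X :=
  A.domain ⊓ B.domain ⊓ C.domain

/-- The Taylor coefficients `P⁽ʲ⁾(z) / j!` of the pencil `P(z) = A + z B + z² C` at `z`, that is
`A + z B + z² C`, `B + 2 z C`, `C`, `0`, `0`, …, on the common domain. -/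
def pencilCoeff (A B C : X →ₗ.[ℂ] X) (z : ℂ) : ℕ → (pencilDomain A B C →ₗ[ℂ] X)
  | 0 => A.toFun ∘ₗ Submodule.inclusion (inf_le_left.trans inf_le_left)
      + z • B.toFun ∘ₗ Submodule.inclusion (inf_le_left.trans inf_le_right)
      + z ^ 2 • C.toFun ∘ₗ Submodule.inclusion inf_le_right
  | 1 => B.toFun ∘ₗ Submodule.inclusion (inf_le_left.trans inf_le_right)
      + (2 * z) • C.toFun ∘ₗ Submodule.inclusion inf_le_right
  | 2 => C.toFun ∘ₗ Submodule.inclusion inf_le_right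
  | _ => 0

/-- The quadratic pencil `P(z) = A + z B + z² C` on the common domain of its coefficients. -/
def pencil (A B C : X →ₗ.[ℂ] X) (z : ℂ) : X →ₗ.[ℂ] X where
  domain := pencilDomain A B C
  toFun := pencilCoeff A B C z 0

/-- The spectrum: all `z` at which `P(z)` fails to be boundedly invertible. -/
def pencilSpectrum (A B C : X →ₗ.[ℂ] X) : Set ℂ :=
  {z | ¬ ∃ R : X →L[ℂ] X, IsBoundedInverse (pencil A B C z) R}

/-- The eigenvalues (point spectrum): all `z` at which `P(z)` has a nontrivial kernel. -/
def pencilEigenvalues (A B C : X →ₗ.[ℂ] X) : Set ℂ :=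
  {z | kernel (pencil A B C z) ≠ ⊥}

/-- The first vectors `u 0` of the Jordan chains `u 0, …, u (k - 1)` of length `k` of the pencil at
`z` (together with zero): these are the chains of vectors of the domain with
`∑ j ≤ i, (1 / j!) P⁽ʲ⁾(z) u (i - j) = 0` for all `i < k`. -/
def leadingVectors (A B C : X →ₗ.[ℂ] X) (z : ℂ) (k : ℕ) : Submodule ℂ (pencilDomain A B C) where
  carrier := {v | ∃ u : ℕ → pencilDomain A B C, u 0 = v ∧
    ∀ i < k, ∑ j ∈ Finset.range (i + 1), pencilCoeff A B C z j (u (i - j)) = 0}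
  zero_mem' := ⟨0, rfl, fun i _ => by simp⟩
  add_mem' := by
    rintro _ _ ⟨u, rfl, hu⟩ ⟨v, rfl, hv⟩
    refine ⟨u + v, rfl, fun i hi => ?_⟩
    simp only [Pi.add_apply, map_add, Finset.sum_add_distrib, hu i hi, hv i hi, add_zero]
  smul_mem' := by
    rintro c _ ⟨u, rfl, hu⟩
    refine ⟨c • u, rfl, fun i hi => ?_⟩
    simp only [Pi.smul_apply, map_smul, ← Finset.smul_sum, hu i hi, smul_zero]

/-- The algebraic multiplicity of `z`: the sum of the partial multiplicities (the lengths of the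
chains of a canonical system of Jordan chains at `z`).  The number of partial multiplicities that
are at least `k` is the dimension of the space of first vectors of the chains of length `k`, so the
sum is `∑_{k ≥ 1} dim (leadingVectors k)`, written here as the supremum of its partial sums. -/
def algMultiplicity (A B C : X →ₗ.[ℂ] X) (z : ℂ) : ℕ∞ :=
  ⨆ n : ℕ, ∑ k ∈ Finset.range n, Cardinal.toENat (Module.rank ℂ (leadingVectors A B C z (k + 1)))

end QuadPencil

end

/-! Bounded operators replace the pencil. With `Q` the orthogonal projection onto `ker A`, let `E`
be the inverse of the compressed `A` on `(ker A)ᗮ` and the identity on `ker A`. Then `E` is a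
bijection from `X` onto the domain of `A` and `A E = 1 - Q`. The hypotheses make `R B` and `R C`
compact on `(ker A)ᗮ`; since `B` is skew-symmetric and `C` symmetric, taking adjoints shows that `B
E` and `C E` are compact, up to finite-rank terms coming from `ker A`. Hence `P(z) E = 1 + K z` with
`K` polynomial in `z` and compact-valued (`exists_isCompactModel`).

The Fredholm alternative gives the pure point spectrum. Locally `1 + K z` has a left inverse up to
an analytic determinant `d z`, whose zeros are exactly the eigenvalues (`exists_local_parametrix`).
If some point is not an eigenvalue, connectedness of the plane makes the zeros of `d` isolated, and
the order of such a zero bounds the lengths of Jordan chains (`exists_order_bound`).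

Under the first alternative a non-eigenvalue must be produced (`exists_notMem_pencilEigenvalues`).
Eigenvectors at distinct positive points span a neutral space of the form `⟪u, A u⟫ + ⟪v, C v⟫`;
finite negative indices, finite-dimensional `ker A` and trivial `ker C` prevent it from being too
large. -/

open Filter Topology
open scoped InnerProductSpace

namespace QuadPencil

/-! ### Finite-rank reduction and determinants for compact perturbations of the identity. -/

section Fredholm

variable {X : Type*} [NormedAddCommGroup X] [InnerProductSpace ℂ X]

/-- A compact operator into a Hilbert space is norm-close to a finite-rank compression. -/
theorem exists_finiteDimensional_norm_sub_starProjection_lt {K : X →L[ℂ] X}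
    (hK : IsCompactOperator K) :
    ∃ (V : Submodule ℂ X) (_ : FiniteDimensional ℂ V), ‖K - V.starProjection * K‖ < 1 := by
  have htb := (hK.isCompact_closure_image_closedBall 1).totallyBounded.subset subset_closure
  obtain ⟨t, ht, hsub⟩ := Metric.totallyBounded_iff.1 htb (1 / 2) (by norm_num)
  have : FiniteDimensional ℂ (Submodule.span ℂ t) := FiniteDimensional.span_of_finite ℂ ht
  refine ⟨Submodule.span ℂ t, this, ?_⟩
  set V := Submodule.span ℂ t
  refine lt_of_le_of_lt (b := 1 / 2) ?_ (by norm_num)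
  refine ContinuousLinearMap.opNorm_le_of_unit_norm (by norm_num) fun x hx => ?_
  obtain ⟨y, hy, hxy⟩ : ∃ y ∈ t, dist (K x) y < 1 / 2 := by
    simpa using hsub ⟨x, by simp [hx], rfl⟩
  have hPy : V.starProjection y = y :=
    Submodule.starProjection_eq_self_iff.2 (Submodule.subset_span hy)
  -- Since `y` lies in `V`, it may be subtracted before projecting onto `Vᗮ`.
  have h1 : (K - V.starProjection * K) x = Vᗮ.starProjection (K x - y) := by
    simp [Submodule.starProjection_orthogonal', hPy]
  rw [h1]
  exact (Submodule.norm_starProjection_apply_le _ _).trans (by rw [← dist_eq_norm]; exact hxy.le)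

/-- The matrix of the compression of `1 + N` to the span of an orthonormal family. -/
noncomputable def compressionMatrix {n : ℕ} (b : Fin n → X) (N : X →L[ℂ] X) :
    Matrix (Fin n) (Fin n) ℂ :=
  1 + Matrix.of fun i j => ⟪b i, N (b j)⟫_ℂ

/-- For the orthogonal projection `P` onto the span of `b`, this is `det • (1 + P N)⁻¹`, written
with the adjugate of the compressed matrix so that it makes sense everywhere. -/
noncomputable def fredholmAdjugate {n : ℕ} (b : Fin n → X) (P N : X →L[ℂ] X) : X →L[ℂ] X :=
  (∑ i, ∑ j, (compressionMatrix b N).adjugate i j •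
    ((innerSL ℂ (b j)).comp (1 - N * (1 - P))).smulRight (b i)) +
    (compressionMatrix b N).det • (1 - P)

variable {n : ℕ} {b : Fin n → X} {P : X →L[ℂ] X}

theorem compressionMatrix_mulVec (N : X →L[ℂ] X) (η : Fin n → ℂ) (i : Fin n) :
    (compressionMatrix b N).mulVec η i = η i + ⟪b i, N (∑ j, η j • b j)⟫_ℂ := by
  simp only [compressionMatrix, Matrix.add_mulVec, Matrix.one_mulVec, Pi.add_apply, map_sum,
    map_smul, inner_sum, inner_smul_right]
  simp [Matrix.mulVec, dotProduct, mul_comm]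

/-- Put `w = (1 + P N) y`. Subtracting `N (1 - P) w = N (y - P y)` from `w` leaves a vector whose
coordinates along `b` are the compressed matrix applied to those of `P y`. Cramer's rule recovers
`det • P y`, and `(1 - P) w = y - P y` supplies the rest. -/
theorem fredholmAdjugate_mul (hb : Orthonormal ℂ b) (hP : ∀ x, P x = ∑ i, ⟪b i, x⟫_ℂ • b i)
    (N : X →L[ℂ] X) :
    fredholmAdjugate b P N * (1 + P * N) = (compressionMatrix b N).det • 1 := by
  have hbP : ∀ i x, ⟪b i, P x⟫_ℂ = ⟪b i, x⟫_ℂ := fun i x => by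
    rw [hP, hb.inner_right_fintype]
  have hPP : ∀ x, P (P x) = P x := fun x => by
    rw [hP (P x)]; simp only [hbP]; exact (hP x).symm
  ext y
  set M := compressionMatrix b N with hM
  have key : ∀ j, ⟪b j, (1 - N * (1 - P)) ((1 + P * N) y)⟫_ℂ
      = M.mulVec (fun i => ⟪b i, y⟫_ℂ) j := fun j => by
    rw [hM, compressionMatrix_mulVec, ← hP]
    simp [hPP, hbP]
    ring
  have hadj : ∀ i, ∑ j, M.adjugate i j * M.mulVec (fun i => ⟪b i, y⟫_ℂ) j
      = M.det * ⟪b i, y⟫_ℂ := fun i => by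
    have := congrFun (Matrix.mulVec_mulVec (fun i => ⟪b i, y⟫_ℂ) M.adjugate M) i
    rw [Matrix.adjugate_mul, Matrix.smul_mulVec, Matrix.one_mulVec] at this
    simpa [Matrix.mulVec, dotProduct] using this
  have h2 : (1 - P) ((1 + P * N) y) = y - P y := by simp [hPP]
  have h3 : ∑ i, ∑ j, M.adjugate i j • ⟪b j, (1 - N * (1 - P)) ((1 + P * N) y)⟫_ℂ • b i
      = M.det • P y := by
    rw [hP, Finset.smul_sum]
    refine Finset.sum_congr rfl fun i _ => ?_
    simp only [key, smul_smul, ← Finset.sum_smul, hadj]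
  rw [mul_apply_eq_comp]
  generalize (1 + P * N) y = w at h2 h3
  simp only [fredholmAdjugate, add_apply, sum_apply, smul_apply,
    ContinuousLinearMap.smulRight_apply, ContinuousLinearMap.comp_apply, innerSL_apply_apply]
  rw [h3, h2, smul_sub, add_sub_cancel]
  rfl

/-- A null vector of the matrix gives the coordinates of some `y` in the range of `P` with `P N y =
-y`. -/
theorem exists_ne_zero_of_det_eq_zero (hb : Orthonormal ℂ b)
    (hP : ∀ x, P x = ∑ i, ⟪b i, x⟫_ℂ • b i) {N : X →L[ℂ] X}
    (hdet : (compressionMatrix b N).det = 0) : ∃ y ≠ 0, (1 + P * N) y = 0 := by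
  obtain ⟨η, hη, hM⟩ := Matrix.exists_mulVec_eq_zero_iff.2 hdet
  refine ⟨∑ j, η j • b j, fun h => hη ?_, ?_⟩
  · exact funext (Fintype.linearIndependent_iff.1 hb.linearIndependent η h)
  · have : ∀ i, ⟪b i, N (∑ j, η j • b j)⟫_ℂ = - η i := fun i => by
      have := congrFun hM i
      rw [compressionMatrix_mulVec] at this
      exact eq_neg_of_add_eq_zero_right this
    rw [add_apply, mul_apply_eq_comp, hP]
    simp only [this]
    simp

/-- On this kernel the identity equals `-K`, hence is compact, and Riesz's theorem applies. -/
theorem finiteDimensional_ker_one_add {K : X →L[ℂ] X} (hK : IsCompactOperator K) :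
    FiniteDimensional ℂ (LinearMap.ker (1 + K).toLinearMap) := by
  set V := LinearMap.ker (1 + K).toLinearMap
  have hV : ∀ x : V, (x : X) = - K x := fun x => by
    have : (1 + K) (x : X) = 0 := x.2
    exact eq_neg_of_add_eq_zero_left this
  have : IsCompactOperator (id : V → V) := by
    have hc : IsCompactOperator ((-K).comp V.subtypeL) := (hK.neg).comp_clm V.subtypeL
    have hcl : IsClosed (V : Set X) := (1 + K).isClosed_ker
    have h := hc.codRestrict (V := V) (fun x => by
      have := hV x
      simp only [ContinuousLinearMap.comp_apply, neg_apply,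
        Submodule.subtypeL_apply]
      rw [← this]; exact x.2) hcl
    refine (congrArg IsCompactOperator (funext fun x => Subtype.ext ?_)).mp h
    exact (hV x).symm
  exact FiniteDimensional.of_isCompactOperator_id this

end Fredholm

/-! ### The analytic Fredholm theorem. -/

section Family

variable {X : Type*} [NormedAddCommGroup X] [InnerProductSpace ℂ X] [CompleteSpace X]

/-- A differentiable family `1 + K z` with `K z` compact has, near each point, a left inverse up
to a scalar analytic factor, and fails to be injective at the zeros of this factor. -/
theorem exists_local_parametrix {K : ℂ → X →L[ℂ] X} (hd : Differentiable ℂ K)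
    (hK : ∀ z, IsCompactOperator (K z)) (z₁ : ℂ) :
    ∃ (d : ℂ → ℂ) (Y : ℂ → X →L[ℂ] X), AnalyticAt ℂ d z₁ ∧ ContinuousAt Y z₁ ∧
      ∀ᶠ z in 𝓝 z₁, Y z * (1 + K z) = d z • 1 ∧ (d z = 0 → ∃ x ≠ 0, (1 + K z) x = 0) := by
  obtain ⟨V, hV, hlt⟩ := exists_finiteDimensional_norm_sub_starProjection_lt (hK z₁)
  set P := V.starProjection with hPdef
  let e := stdOrthonormalBasis ℂ V
  let b : Fin (Module.finrank ℂ V) → X := fun i => (e i : X)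
  have hb : Orthonormal ℂ b := e.orthonormal.comp_linearIsometry V.subtypeₗᵢ
  have hP : ∀ x, P x = ∑ i, ⟪b i, x⟫_ℂ • b i := fun x => by
    rw [hPdef, Submodule.starProjection_apply, e.orthogonalProjectionOnto_apply_eq_sum]
    simp [b]
  -- `W z` is within distance less than 1 of the identity at `z₁`, so it stays invertible nearby.
  -- Dividing it out on the right leaves `1 + P N z`, a finite-rank perturbation of the identity.
  let W : ℂ → X →L[ℂ] X := fun z => 1 + (K z - P * K z)
  let N : ℂ → X →L[ℂ] X := fun z => K z * Ring.inverse (W z)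
  have hWd : Differentiable ℂ W := by fun_prop
  have hW : IsUnit (W z₁) := by
    have := isUnit_one_sub_of_norm_lt_one (x := -(K z₁ - P * K z₁)) (by rwa [norm_neg])
    rwa [sub_neg_eq_add] at this
  have hKa : AnalyticAt ℂ K z₁ := hd.analyticAt z₁
  have hIa : AnalyticAt ℂ (fun z => Ring.inverse (W z)) z₁ := by
    obtain ⟨u, hu⟩ := hW
    have := analyticAt_inverse (𝕜 := ℂ) u
    rw [hu] at this
    exact this.comp (hWd.analyticAt z₁)
  have hNa : AnalyticAt ℂ N z₁ := hKa.mul hIa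
  have hent : ∀ i j, AnalyticAt ℂ (fun z => compressionMatrix b (N z) i j) z₁ := fun i j => by
    have h : AnalyticAt ℂ (fun z => innerSL ℂ (b i) (N z (b j))) z₁ :=
      ((innerSL ℂ (b i)).comp (ContinuousLinearMap.apply ℂ X (b j))).analyticAt _ |>.comp hNa
    exact (analyticAt_const (v := (1 : Matrix _ _ ℂ) i j)).add h
  have hcont : ContinuousAt (fun z => compressionMatrix b (N z)) z₁ :=
    continuousAt_pi.2 fun i => continuousAt_pi.2 fun j => (hent i j).continuousAt
  have hdet : AnalyticAt ℂ (fun z => (compressionMatrix b (N z)).det) z₁ := by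
    simp only [Matrix.det_apply]
    exact Finset.analyticAt_fun_sum _ fun σ _ =>
      (Finset.analyticAt_fun_prod _ fun i _ => hent _ _).const_smul
  have hadj : ContinuousAt (fun z => fredholmAdjugate b P (N z)) z₁ := by
    have h1 : ContinuousAt (fun z => (compressionMatrix b (N z)).adjugate) z₁ :=
      (Continuous.matrix_adjugate continuous_id).continuousAt.comp hcont
    have h2 : ∀ i j, ContinuousAt (fun z => (compressionMatrix b (N z)).adjugate i j) z₁ :=
      fun i j => (continuousAt_pi.1 (continuousAt_pi.1 h1 i) j)
    have hNc := hNa.continuousAt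
    have h3 : ∀ i j, ContinuousAt (fun z =>
        ((innerSL ℂ (b j)).comp (1 - N z * (1 - P))).smulRight (b i)) z₁ := fun i j => by
      have : Continuous fun T : X →L[ℂ] X => ((innerSL ℂ (b j)).comp T).smulRight (b i) := by
        fun_prop
      exact this.continuousAt.comp (continuousAt_const.sub (hNc.mul continuousAt_const))
    unfold fredholmAdjugate
    refine ContinuousAt.add ?_ (hdet.continuousAt.smul continuousAt_const)
    exact tendsto_finsetSum _ fun i _ => tendsto_finsetSum _ fun j _ => (h2 i j).smul (h3 i j)
  refine ⟨fun z => (compressionMatrix b (N z)).det,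
    fun z => Ring.inverse (W z) * fredholmAdjugate b P (N z), hdet, hIa.continuousAt.mul hadj, ?_⟩
  have hev : ∀ᶠ z in 𝓝 z₁, IsUnit (W z) :=
    hWd.continuous.continuousAt.eventually (Units.isOpen.mem_nhds hW)
  filter_upwards [hev] with z hz
  have hG : 1 + K z = (1 + P * N z) * W z := by
    have h1 : Ring.inverse (W z) * W z = 1 := Ring.inverse_mul_cancel _ hz
    have : (1 + P * N z) * W z = W z + P * K z * (Ring.inverse (W z) * W z) := by
      simp only [N]; noncomm_ring
    rw [this, h1]; simp only [W]; noncomm_ring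
  refine ⟨?_, fun h0 => ?_⟩
  · rw [hG, mul_assoc, ← mul_assoc (fredholmAdjugate b P (N z)), fredholmAdjugate_mul hb hP,
      smul_mul_assoc, one_mul, mul_smul_comm, Ring.inverse_mul_cancel _ hz]
  · obtain ⟨y, hy, h⟩ := exists_ne_zero_of_det_eq_zero hb hP h0
    have h1 : W z (Ring.inverse (W z) y) = y := by
      rw [← mul_apply_eq_comp, Ring.mul_inverse_cancel _ hz]; rfl
    refine ⟨Ring.inverse (W z) y, fun h' => hy ?_, ?_⟩
    · rw [← h1, h', map_zero]
    · rw [hG, mul_apply_eq_comp, h1, h]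

/-- Fredholm alternative for `1 + K`. -/
theorem isUnit_one_add_of_injective {K : X →L[ℂ] X} (hK : IsCompactOperator K)
    (hinj : ∀ x, (1 + K) x = 0 → x = 0) : IsUnit (1 + K) := by
  rcases hK.hasEigenvalue_or_mem_resolventSet (μ := -1) (by norm_num) with h | h
  · obtain ⟨x, hx⟩ := h.exists_hasEigenvector
    refine absurd (hinj x ?_) hx.2
    have := hx.apply_eq_smul
    simp only [ContinuousLinearMap.coe_coe] at this
    simp [this]
  · rw [spectrum.mem_resolventSet_iff] at h
    have h2 := h.neg
    have : -((algebraMap ℂ (X →L[ℂ] X)) (-1) - K) = 1 + K := by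
      rw [map_neg, map_one]; abel
    rwa [this] at h2

/-- The analytic Fredholm theorem: the points where `1 + K z` has a kernel do not accumulate,
unless they fill the plane. -/
theorem not_accPt_noninjective {K : ℂ → X →L[ℂ] X} (hd : Differentiable ℂ K)
    (hK : ∀ z, IsCompactOperator (K z)) {S : Set ℂ}
    (hS : ∀ z, z ∈ S ↔ ∃ x ≠ 0, (1 + K z) x = 0) (hne : S ≠ Set.univ) (z : ℂ) :
    ¬ AccPt z (𝓟 S) := by
  have hloc : ∀ z, AccPt z (𝓟 S) → S ∈ 𝓝 z := fun z hz => by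
    obtain ⟨d, Y, hda, -, hev⟩ := exists_local_parametrix hd hK z
    have hSd : ∀ᶠ w in 𝓝 z, (w ∈ S ↔ d w = 0) := by
      filter_upwards [hev] with w hw
      rw [hS]
      refine ⟨fun ⟨x, hx, h0⟩ => ?_, hw.2⟩
      have := congrArg (fun T => T x) hw.1
      simp only [mul_apply_eq_comp, h0, map_zero] at this
      simpa [hx] using this.symm
    rcases hda.eventually_eq_zero_or_eventually_ne_zero with h | h
    · filter_upwards [h, hSd] with w h1 h2 using h2.2 h1
    · rw [accPt_iff_frequently_nhdsNE] at hz
      refine absurd ?_ hz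
      change ∀ᶠ w in 𝓝[≠] z, ¬ w ∈ S
      filter_upwards [h, hSd.filter_mono nhdsWithin_le_nhds] with w h1 h2 h3 using h1 (h2.1 h3)
  -- The derived set of `S` is closed; by `hloc` it is also open, hence empty or the whole plane.
  have hcl : IsClosed {z | AccPt z (𝓟 S)} := isClosed_derivedSet S
  have hop : IsOpen {z | AccPt z (𝓟 S)} := by
    rw [isOpen_iff_mem_nhds]
    intro z hz
    filter_upwards [eventually_mem_nhds_iff.2 (hloc z hz)] with w hw
    refine accPt_iff_frequently_nhdsNE.2 ?_
    exact (Filter.Eventually.filter_mono nhdsWithin_le_nhds hw).frequently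
  rcases isClopen_iff.1 ⟨hcl, hop⟩ with h | h
  · exact fun hz => (h ▸ hz : z ∈ (∅ : Set ℂ))
  · exact absurd (Set.eq_univ_of_forall fun w => mem_of_mem_nhds (hloc w (h ▸ Set.mem_univ w :)))
      hne

/-- The order to which a family `1 + K z` can annihilate a nonvanishing germ at a point which is
not an accumulation point of the points of noninjectivity is bounded. -/
theorem exists_order_bound {K : ℂ → X →L[ℂ] X} (hd : Differentiable ℂ K)
    (hK : ∀ z, IsCompactOperator (K z)) {z : ℂ}
    (hz : ∃ᶠ w in 𝓝 z, ∀ x, (1 + K w) x = 0 → x = 0) :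
    ∃ m : ℕ, ∀ p q : ℂ → X, Continuous p → Continuous q →
      (∀ t, (1 + K (z + t)) (p t) = t ^ (m + 1) • q t) → p 0 = 0 := by
  obtain ⟨d, Y, hda, hY, hev⟩ := exists_local_parametrix hd hK z
  have hnz : ¬ ∀ᶠ w in 𝓝 z, d w = 0 := fun h => by
    refine hz ?_
    filter_upwards [h, hev] with w h1 h2 h3
    obtain ⟨x, hx, h0⟩ := h2.2 h1
    exact hx (h3 x h0)
  -- The bound `m` is the order of the zero of `d` at `z`.
  obtain ⟨m, g, hg, hg0, hdg⟩ := hda.exists_eventuallyEq_pow_smul_nonzero_iff.2 hnz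
  refine ⟨m, fun p q hp hq hpq => ?_⟩
  have hshift : Tendsto (fun t => z + t) (𝓝[≠] (0 : ℂ)) (𝓝 z) := by
    have : Continuous fun t : ℂ => z + t := by fun_prop
    have h := this.tendsto 0
    rw [add_zero] at h
    exact h.mono_left nhdsWithin_le_nhds
  -- Applying `Y (z + t)` to the hypothesis gives `d (z + t) • p t = t ^ (m + 1) • Y (z + t) (q t)`.
  -- Cancelling `t ^ m` leaves a factor `t` on the right, so the limit `t → 0` forces `g z • p 0 =
  -- 0`.
  have heq : (fun t => g (z + t) • p t) =ᶠ[𝓝[≠] 0] fun t => t • Y (z + t) (q t) := by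
    filter_upwards [hshift.eventually hev, hshift.eventually hdg, self_mem_nhdsWithin]
      with t h1 h2 ht
    have h3 := congrArg (fun T => T (p t)) h1.1
    simp only [mul_apply_eq_comp, hpq, h2] at h3
    simp only [map_smul, smul_apply, one_apply_eq_self,
      add_sub_cancel_left, smul_eq_mul, pow_succ, mul_smul] at h3
    exact (smul_right_injective X (pow_ne_zero m ht) h3).symm
  have hl : Tendsto (fun t => g (z + t) • p t) (𝓝[≠] 0) (𝓝 (g z • p 0)) :=
    (hg.continuousAt.tendsto.comp hshift).smul ((hp.tendsto 0).mono_left nhdsWithin_le_nhds)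
  have hr : Tendsto (fun t => t • Y (z + t) (q t)) (𝓝[≠] 0) (𝓝 ((0 : ℂ) • Y z (q 0))) :=
    (tendsto_id.mono_left nhdsWithin_le_nhds).smul
      ((isBoundedBilinearMap_apply (𝕜 := ℂ)).continuous.tendsto (Y z, q 0) |>.comp
        ((hY.tendsto.comp hshift).prodMk_nhds ((hq.tendsto 0).mono_left nhdsWithin_le_nhds)))
  have := tendsto_nhds_unique (hl.congr' heq) hr
  simpa [hg0] using this

end Family

/-! ### Parametrizing the domain of `A` and transferring compactness by duality. -/

section Reduction

variable {X : Type*} [NormedAddCommGroup X] [InnerProductSpace ℂ X]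

theorem mem_kernel_iff {T : X →ₗ.[ℂ] X} {x : X} :
    x ∈ kernel T ↔ ∃ h : x ∈ T.domain, T ⟨x, h⟩ = 0 := by
  constructor
  · rintro ⟨u, hu, rfl⟩
    exact ⟨u.2, hu⟩
  · rintro ⟨h, h0⟩
    exact ⟨⟨x, h⟩, h0, rfl⟩

theorem inner_map_eq_of_isSelfAdjoint [CompleteSpace X] {T : X →ₗ.[ℂ] X} (hT : IsSelfAdjoint T)
    (u v : T.domain) : ⟪T u, (v : X)⟫_ℂ = ⟪(u : X), T v⟫_ℂ := by
  have h := LinearPMap.adjoint_isFormalAdjoint hT.dense_domain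
  rw [LinearPMap.isSelfAdjoint_def.1 hT] at h
  exact h u v

/-- Schauder's theorem through `‖T* x‖² ≤ ‖T T* x‖ ‖x‖`: a finite `ε² / 2`-net for the image of the
unit ball under the compact operator `T T*` yields an `ε`-net for its image under `T*`, as
differences in the ball have norm at most 2. -/
theorem _root_.IsCompactOperator.adjoint {Y : Type*} [NormedAddCommGroup Y]
    [InnerProductSpace ℂ Y] [CompleteSpace X] [CompleteSpace Y] {T : X →L[ℂ] Y}
    (hT : IsCompactOperator T) : IsCompactOperator (ContinuousLinearMap.adjoint T) := by
  have hTT : IsCompactOperator (T.comp (ContinuousLinearMap.adjoint T)) := hT.comp_clm _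
  rw [← ContinuousLinearMap.coe_coe,
    isCompactOperator_iff_isCompact_closure_image_closedBall _ one_pos]
  refine TotallyBounded.isCompact_of_isClosed (TotallyBounded.closure ?_) isClosed_closure
  have htb := (hTT.isCompact_closure_image_closedBall 1).totallyBounded.subset subset_closure
  rw [Metric.totallyBounded_iff]
  intro ε hε
  obtain ⟨t, ht, hfin, hsub⟩ := totallyBounded_iff_subset.1 htb _
    (Metric.dist_mem_uniformity (show (0 : ℝ) < ε ^ 2 / 2 by positivity))
  choose! f hf using fun y (hy : y ∈ t) => ht hy
  refine ⟨(fun y => ContinuousLinearMap.adjoint T (f y)) '' t, hfin.image _, ?_⟩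
  rintro _ ⟨x, hx, rfl⟩
  obtain ⟨y, hy, hxy⟩ := Set.mem_iUnion₂.1 (hsub ⟨x, hx, rfl⟩)
  simp only [Set.mem_iUnion, Set.mem_image, exists_prop, exists_exists_and_eq_and]
  refine ⟨y, hy, ?_⟩
  have hfy := hf y hy
  have hxy' : ‖T (ContinuousLinearMap.adjoint T (x - f y))‖ < ε ^ 2 / 2 := by
    rw [map_sub, map_sub, ← dist_eq_norm]
    have h2 : T (ContinuousLinearMap.adjoint T (f y)) = y := hfy.2
    rw [h2]
    exact hxy
  have hn : ‖x - f y‖ ≤ 2 := by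
    have h1 : ‖x‖ ≤ 1 := by simpa using hx
    have h2 : ‖f y‖ ≤ 1 := by simpa using hfy.1
    exact (norm_sub_le _ _).trans (by linarith)
  have hsq : ‖ContinuousLinearMap.adjoint T (x - f y)‖ ^ 2
      ≤ ‖T (ContinuousLinearMap.adjoint T (x - f y))‖ * ‖x - f y‖ := by
    rw [← inner_self_eq_norm_sq (𝕜 := ℂ), ContinuousLinearMap.adjoint_inner_right]
    exact (RCLike.re_le_norm _).trans (norm_inner_le_norm _ _)
  rw [Metric.mem_ball, dist_eq_norm, ContinuousLinearMap.coe_coe, ← map_sub]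
  refine lt_of_pow_lt_pow_left₀ 2 hε.le (hsq.trans_lt ?_)
  nlinarith [norm_nonneg (T (ContinuousLinearMap.adjoint T (x - f y))), norm_nonneg (x - f y)]

/-- The bounded operator on `X` which is `R` on `Kᗮ` and the identity on `K`.  If `K` is the kernel
of a self-adjoint operator and `R` inverts its compression to `Kᗮ`, this parametrizes the domain. -/
noncomputable def domainParam (K : Submodule ℂ X) [K.HasOrthogonalProjection] (R : Kᗮ →L[ℂ] Kᗮ) :
    X →L[ℂ] X :=
  Kᗮ.subtypeL.comp (R.comp Kᗮ.orthogonalProjectionOnto) + K.starProjection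

theorem domainParam_apply (K : Submodule ℂ X) [K.HasOrthogonalProjection] (R : Kᗮ →L[ℂ] Kᗮ)
    (x : X) : domainParam K R x = R (Kᗮ.orthogonalProjectionOnto x) + K.starProjection x :=
  rfl

variable {A : X →ₗ.[ℂ] X}

/-- Symmetry makes the range of `A` orthogonal to its kernel. The outer projection in the
compression of `A` therefore loses nothing. -/
theorem map_mem_orthogonal_kernel (hA : ∀ u v : A.domain, ⟪A u, (v : X)⟫_ℂ = ⟪(u : X), A v⟫_ℂ)
    (u : A.domain) : A u ∈ (kernel A)ᗮ := by
  rw [Submodule.mem_orthogonal]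
  intro k hk
  obtain ⟨h, h0⟩ := mem_kernel_iff.1 hk
  rw [show k = ((⟨k, h⟩ : A.domain) : X) from rfl, ← hA, h0, inner_zero_left]

theorem kernel_le_domain : kernel A ≤ A.domain := fun _ h => (mem_kernel_iff.1 h).1

variable [FiniteDimensional ℂ (kernel A)] {R : (kernel A)ᗮ →L[ℂ] (kernel A)ᗮ}

theorem exists_map_eq (hA : ∀ u v : A.domain, ⟪A u, (v : X)⟫_ℂ = ⟪(u : X), A v⟫_ℂ)
    (hR : IsBoundedInverse (compression A (kernel A)ᗮ) R) (g : (kernel A)ᗮ) :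
    ∃ u : A.domain, (u : X) = R g ∧ A u = g := by
  obtain ⟨u, hu, hg⟩ := hR.2 g
  have hAu : ((kernel A)ᗮ.orthogonalProjectionOnto (A ⟨u, u.2⟩) : (kernel A)ᗮ) = g := hg
  refine ⟨⟨u, u.2⟩, congrArg Subtype.val hu, ?_⟩
  have := Submodule.starProjection_eq_self_iff.2 (map_mem_orthogonal_kernel hA ⟨u, u.2⟩)
  rw [← this, Submodule.starProjection_apply, hAu]

theorem exists_map_domainParam (hA : ∀ u v : A.domain, ⟪A u, (v : X)⟫_ℂ = ⟪(u : X), A v⟫_ℂ)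
    (hR : IsBoundedInverse (compression A (kernel A)ᗮ) R) (x : X) :
    ∃ u : A.domain, (u : X) = domainParam (kernel A) R x ∧
      A u = x - (kernel A).starProjection x := by
  obtain ⟨u, hu, hAu⟩ := exists_map_eq hA hR ((kernel A)ᗮ.orthogonalProjectionOnto x)
  obtain ⟨h, h0⟩ := mem_kernel_iff.1 ((kernel A).starProjection_apply_mem x)
  refine ⟨u + ⟨_, h⟩, ?_, ?_⟩
  · simp [domainParam_apply, hu]
  · rw [LinearPMap.map_add, h0, hAu, add_zero]
    exact Submodule.starProjection_orthogonal_val x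

theorem domainParam_mem (hA : ∀ u v : A.domain, ⟪A u, (v : X)⟫_ℂ = ⟪(u : X), A v⟫_ℂ)
    (hR : IsBoundedInverse (compression A (kernel A)ᗮ) R) (x : X) :
    domainParam (kernel A) R x ∈ A.domain := by
  obtain ⟨u, hu, -⟩ := exists_map_domainParam hA hR x
  rw [← hu]; exact u.2

theorem map_domainParam (hA : ∀ u v : A.domain, ⟪A u, (v : X)⟫_ℂ = ⟪(u : X), A v⟫_ℂ)
    (hR : IsBoundedInverse (compression A (kernel A)ᗮ) R) (x : X)
    (h : domainParam (kernel A) R x ∈ A.domain) :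
    A ⟨domainParam (kernel A) R x, h⟩ = x - (kernel A).starProjection x := by
  obtain ⟨u, hu, h'⟩ := exists_map_domainParam hA hR x
  rw [← h']
  exact congrArg A (Subtype.ext hu.symm)

theorem exists_domainParam_eq (hA : ∀ u v : A.domain, ⟪A u, (v : X)⟫_ℂ = ⟪(u : X), A v⟫_ℂ)
    (hR : IsBoundedInverse (compression A (kernel A)ᗮ) R) {u : X} (hu : u ∈ A.domain) :
    ∃ x, domainParam (kernel A) R x = u := by
  set k := (kernel A).starProjection u with hk
  have hkm : k ∈ kernel A := (kernel A).starProjection_apply_mem u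
  obtain ⟨hkd, hk0⟩ := mem_kernel_iff.1 hkm
  have hw : u - k ∈ (kernel A)ᗮ := (kernel A).sub_starProjection_mem_orthogonal u
  have hwd : u - k ∈ A.domain := sub_mem hu hkd
  have hR1 := hR.1 ⟨⟨u - k, hw⟩, hwd⟩
  change R ((kernel A)ᗮ.orthogonalProjectionOnto (A ⟨u - k, hwd⟩)) = ⟨u - k, hw⟩ at hR1
  have hAo := map_mem_orthogonal_kernel hA ⟨u - k, hwd⟩
  -- The preimage of `u = (u - k) + k`: apply `A` to the part in `(ker A)ᗮ` and keep the part in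
  -- `ker A`.
  refine ⟨A ⟨u - k, hwd⟩ + k, ?_⟩
  have hPk : (kernel A)ᗮ.orthogonalProjectionOnto k = 0 :=
    Submodule.orthogonalProjectionOnto_orthogonal_apply_eq_zero hkm
  have hQA : (kernel A).starProjection (A ⟨u - k, hwd⟩) = 0 :=
    (Submodule.starProjection_apply_eq_zero_iff _).2 hAo
  rw [domainParam_apply, map_add ((kernel A)ᗮ.orthogonalProjectionOnto), hPk, add_zero,
    map_add, hR1, hQA,
    Submodule.starProjection_eq_self_iff.2 hkm]
  simp

/-- Applying `A` gives `x = Q x`, so `x` lies in `ker A`, where the parametrization is the identity.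
-/
theorem domainParam_eq_zero (hA : ∀ u v : A.domain, ⟪A u, (v : X)⟫_ℂ = ⟪(u : X), A v⟫_ℂ)
    (hR : IsBoundedInverse (compression A (kernel A)ᗮ) R) {x : X}
    (hx : domainParam (kernel A) R x = 0) : x = 0 := by
  have h1 := map_domainParam hA hR x (domainParam_mem hA hR x)
  have h2 : A ⟨domainParam (kernel A) R x, domainParam_mem hA hR x⟩ = 0 := by
    rw [show (⟨domainParam (kernel A) R x, domainParam_mem hA hR x⟩ : A.domain) = 0 from
      Subtype.ext hx, LinearPMap.map_zero]
  have hQ : x = (kernel A).starProjection x := by rw [← sub_eq_zero, ← h1, h2]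
  have hxk : x ∈ kernel A := Submodule.starProjection_eq_self_iff.1 hQ.symm
  rw [domainParam_apply, Submodule.orthogonalProjectionOnto_orthogonal_apply_eq_zero hxk, map_zero,
    ← hQ] at hx
  simpa using hx

theorem inner_boundedInverse_left (hA : ∀ u v : A.domain, ⟪A u, (v : X)⟫_ℂ = ⟪(u : X), A v⟫_ℂ)
    (hR : IsBoundedInverse (compression A (kernel A)ᗮ) R) (f g : (kernel A)ᗮ) :
    ⟪R f, g⟫_ℂ = ⟪f, R g⟫_ℂ := by
  obtain ⟨u, hu, hAu⟩ := exists_map_eq hA hR f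
  obtain ⟨w, hw, hAw⟩ := exists_map_eq hA hR g
  rw [Submodule.coe_inner, Submodule.coe_inner, ← hu, ← hw, ← hAu, ← hAw, hA]

/-- If `T` is symmetric or skew-symmetric and `R T` is compact on `(ker A)ᗮ`, then `T` composed with
the parametrization of the domain of `A` is bounded and compact. -/
theorem exists_compact_comp_domainParam [CompleteSpace X] (hdense : Dense (A.domain : Set X))
    (hA : ∀ u v : A.domain, ⟪A u, (v : X)⟫_ℂ = ⟪(u : X), A v⟫_ℂ)
    (hR : IsBoundedInverse (compression A (kernel A)ᗮ) R)
    {T : X →ₗ.[ℂ] X} {σ : ℂ} (hσ : σ * σ = 1)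
    (hT : ∀ u v : T.domain, ⟪T u, (v : X)⟫_ℂ = σ * ⟪(u : X), T v⟫_ℂ)
    (hAT : A.domain ≤ T.domain)
    (hcpt : IsCompactOp (R.toLinearMap.compPMap (compression T (kernel A)ᗮ))) :
    ∃ G : X →L[ℂ] X, IsCompactOperator G ∧ ∀ x (h : domainParam (kernel A) R x ∈ T.domain),
      G x = T ⟨domainParam (kernel A) R x, h⟩ := by
  obtain ⟨S, hS, hST⟩ := hcpt
  have hT' : ∀ u v : T.domain, ⟪(u : X), T v⟫_ℂ = σ * ⟪T u, (v : X)⟫_ℂ := fun u v => by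
    rw [hT, ← mul_assoc, hσ, one_mul]
  have hSf : ∀ (f : (kernel A)ᗮ) (hf : (f : X) ∈ T.domain),
      S f = R ((kernel A)ᗮ.orthogonalProjectionOnto (T ⟨f, hf⟩)) := fun f hf => hST ⟨f, hf⟩
  have hRd : ∀ g : (kernel A)ᗮ, (R g : X) ∈ T.domain := fun g => by
    obtain ⟨u, hu, -⟩ := exists_map_eq hA hR g
    rw [← hu]; exact hAT u.2
  -- On `(ker A)ᗮ` the compression of `T R` is `σ S*`, because `S` extends `R T` and `R` is
  -- symmetric. Testing against `A.domain ∩ (ker A)ᗮ` suffices: removing the `ker A` component stays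
  -- in `A.domain`, and that component is orthogonal to `y`.
  have hadj : ∀ g : (kernel A)ᗮ, (kernel A)ᗮ.orthogonalProjectionOnto (T ⟨R g, hRd g⟩)
      = σ • ContinuousLinearMap.adjoint S g := fun g => by
    rw [← sub_eq_zero]
    have key : ∀ f : (kernel A)ᗮ, (f : X) ∈ A.domain →
        ⟪f, (kernel A)ᗮ.orthogonalProjectionOnto (T ⟨R g, hRd g⟩)
          - σ • ContinuousLinearMap.adjoint S g⟫_ℂ = 0 := fun f hf => by
      rw [inner_sub_right, inner_smul_right, ContinuousLinearMap.adjoint_inner_right,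
        hSf f (hAT hf), inner_boundedInverse_left hA hR,
        Submodule.inner_orthogonalProjectionOnto_eq_of_mem_right,
        Submodule.inner_orthogonalProjectionOnto_eq_of_mem_left]
      exact sub_eq_zero.2 (hT' ⟨f, hAT hf⟩ ⟨R g, hRd g⟩)
    generalize (kernel A)ᗮ.orthogonalProjectionOnto (T ⟨R g, hRd g⟩)
      - σ • ContinuousLinearMap.adjoint S g = y at key
    refine Subtype.ext (hdense.eq_zero_of_inner_right ℂ fun u hu => ?_)
    have hQu := (kernel A).starProjection_apply_mem u
    have h1 := key ⟨u - (kernel A).starProjection u,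
      (kernel A).sub_starProjection_mem_orthogonal u⟩ (sub_mem hu (kernel_le_domain hQu))
    rw [Submodule.coe_inner, inner_sub_left, Submodule.inner_right_of_mem_orthogonal hQu y.2,
      sub_zero] at h1
    exact h1
  let τl : kernel A →ₗ[ℂ] X := T.toFun ∘ₗ Submodule.inclusion (kernel_le_domain.trans hAT)
  let τ : kernel A →L[ℂ] X := LinearMap.toContinuousLinearMap τl
  have hτ : ∀ k : kernel A, τ k = T ⟨k, hAT (kernel_le_domain k.2)⟩ := fun k => rfl
  -- The `ker A` component of `T R g` is governed by the adjoint of `τ`, the restriction of `T` to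
  -- `ker A`. Both this term and `τ` itself have finite rank.
  have hker : ∀ g : (kernel A)ᗮ, (kernel A).orthogonalProjectionOnto (T ⟨R g, hRd g⟩)
      = σ • ContinuousLinearMap.adjoint τ (R g : X) := fun g => by
    refine ext_inner_left ℂ fun k => ?_
    rw [inner_smul_right, ContinuousLinearMap.adjoint_inner_right, hτ,
      Submodule.inner_orthogonalProjectionOnto_eq_of_mem_left]
    exact hT' ⟨k, hAT (kernel_le_domain k.2)⟩ ⟨R g, hRd g⟩
  refine ⟨σ • (kernel A)ᗮ.subtypeL.comp ((ContinuousLinearMap.adjoint S).comp (kernel A)ᗮ.orthogonalProjectionOnto)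
    + σ • (kernel A).subtypeL.comp ((ContinuousLinearMap.adjoint τ).comp
      ((kernel A)ᗮ.subtypeL.comp (R.comp (kernel A)ᗮ.orthogonalProjectionOnto)))
    + τ.comp (kernel A).orthogonalProjectionOnto, ?_, fun x h => ?_⟩
  · have : ProperSpace (kernel A) := FiniteDimensional.proper ℂ _
    have hfin : IsCompactOperator (kernel A).subtypeL :=
      isCompactOperator_of_locallyCompactSpace_rng (kernel A).subtypeL
    have hfin' : IsCompactOperator τ := isCompactOperator_of_locallyCompactSpace_rng τ
    exact (((hS.adjoint.comp_clm (kernel A)ᗮ.orthogonalProjectionOnto).clm_comp (kernel A)ᗮ.subtypeL).smul σ).add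
      ((hfin.comp_clm ((ContinuousLinearMap.adjoint τ).comp
      ((kernel A)ᗮ.subtypeL.comp (R.comp (kernel A)ᗮ.orthogonalProjectionOnto)))).smul σ)
      |>.add (hfin'.comp_clm (kernel A).orthogonalProjectionOnto)
  · set g := (kernel A)ᗮ.orthogonalProjectionOnto x with hg
    set k := (kernel A).orthogonalProjectionOnto x with hk
    have hsplit : T ⟨domainParam (kernel A) R x, h⟩ = T ⟨R g, hRd g⟩ + τ k := by
      rw [hτ, ← LinearPMap.map_add]
      rfl
    have hdec : T ⟨R g, hRd g⟩ = ((kernel A)ᗮ.orthogonalProjectionOnto (T ⟨R g, hRd g⟩) : X)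
        + ((kernel A).orthogonalProjectionOnto (T ⟨R g, hRd g⟩) : X) := by
      rw [add_comm]
      exact (Submodule.starProjection_add_starProjection_orthogonal _).symm
    rw [hsplit, hdec, hadj, hker]
    simp [← hg, ← hk]

end Reduction

/-! ### Symmetric forms with finite negative index. -/

section Index

variable {X : Type*} [NormedAddCommGroup X] [InnerProductSpace ℂ X] {S : X →ₗ.[ℂ] X}

theorem re_inner_map_add_smul (hS : ∀ u v : S.domain, ⟪S u, (v : X)⟫_ℂ = ⟪(u : X), S v⟫_ℂ)
    (u w : S.domain) (c : ℂ) :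
    (⟪((u + c • w : S.domain) : X), S (u + c • w)⟫_ℂ).re = (⟪(u : X), S u⟫_ℂ).re
      + 2 * (star c * ⟪(w : X), S u⟫_ℂ).re + ‖c‖ ^ 2 * (⟪(w : X), S w⟫_ℂ).re := by
  have h1 : ⟪(u : X), S w⟫_ℂ = star ⟪(w : X), S u⟫_ℂ := by
    rw [← hS]; exact (inner_conj_symm _ _).symm
  have h2 : ((‖c‖ ^ 2 : ℝ) : ℂ) = star c * c := by
    rw [mul_comm]; exact_mod_cast (Complex.mul_conj' c).symm
  have h3 : ‖c‖ ^ 2 * (⟪(w : X), S w⟫_ℂ).re = (star c * c * ⟪(w : X), S w⟫_ℂ).re := by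
    rw [← h2, Complex.re_ofReal_mul]
  rw [h3]
  simp only [LinearPMap.map_add, LinearPMap.map_smul, Submodule.coe_add, Submodule.coe_smul,
    inner_add_left, inner_add_right, inner_smul_left, inner_smul_right, h1, Complex.add_re]
  clear h1
  generalize ⟪(w : X), S u⟫_ℂ = p
  generalize ⟪(w : X), S w⟫_ℂ = q
  simp only [Complex.star_def, Complex.mul_re, Complex.mul_im, Complex.add_re,
    Complex.add_im, Complex.conj_re, Complex.conj_im]
  ring

/-- A maximal negative definite subspace: the form is nonnegative on its orthogonal complement with
respect to the form. -/
theorem exists_negative_submodule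
    (hS : ∀ u v : S.domain, ⟪S u, (v : X)⟫_ℂ = ⟪(u : X), S v⟫_ℂ) (hn : negIndex S ≠ ⊤) :
    ∃ V : Submodule ℂ S.domain, FiniteDimensional ℂ V ∧
      (∀ u ∈ V, u ≠ 0 → (⟪(u : X), S u⟫_ℂ).re < 0) ∧
      ∀ u : S.domain, (∀ v ∈ V, ⟪(v : X), S u⟫_ℂ = 0) → 0 ≤ (⟪(u : X), S u⟫_ℂ).re := by
  have : Nonempty {V : Submodule ℂ S.domain // ∀ u ∈ V, u ≠ 0 → (⟪(u : X), S u⟫_ℂ).re < 0} :=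
    ⟨⟨⊥, fun u hu h => absurd ((Submodule.mem_bot ℂ).1 hu) h⟩⟩
  obtain ⟨⟨V, hV⟩, hmax⟩ := ENat.exists_eq_iSup_of_lt_top (lt_top_iff_ne_top.2 hn)
  have hle : ∀ W : Submodule ℂ S.domain, (∀ u ∈ W, u ≠ 0 → (⟪(u : X), S u⟫_ℂ).re < 0) →
      Cardinal.toENat (Module.rank ℂ W) ≤ Cardinal.toENat (Module.rank ℂ V) := fun W hW => by
    rw [hmax]
    exact le_iSup (fun V : {V : Submodule ℂ S.domain // ∀ u ∈ V, u ≠ 0 →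
      (⟪(u : X), S u⟫_ℂ).re < 0} => Cardinal.toENat (Module.rank ℂ V.1)) ⟨W, hW⟩
  have hfin : Module.Finite ℂ V := by
    rw [← Module.rank_lt_aleph0_iff, ← not_le, ← Cardinal.toENat_eq_top, hmax]
    exact hn
  refine ⟨V, hfin, hV, fun u hu => ?_⟩
  by_contra! hneg
  -- Adjoining a negative vector that is form-orthogonal to `V` keeps the form negative definite,
  -- contradicting the maximal dimension of `V`.
  have hW : ∀ w ∈ V ⊔ Submodule.span ℂ {u}, w ≠ 0 → (⟪(w : X), S w⟫_ℂ).re < 0 := by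
    intro w hw hw0
    obtain ⟨v, hv, y, hy, rfl⟩ := Submodule.mem_sup.1 hw
    obtain ⟨c, rfl⟩ := Submodule.mem_span_singleton.1 hy
    have huv : ⟪(u : X), S v⟫_ℂ = 0 := by
      rw [← hS, ← inner_conj_symm, hu v hv, map_zero]
    rw [re_inner_map_add_smul hS, huv, mul_zero, Complex.zero_re, mul_zero, add_zero]
    by_cases hv0 : v = 0
    · have hc : c ≠ 0 := fun h => hw0 (by simp [hv0, h])
      have : 0 < ‖c‖ ^ 2 := by positivity
      simp only [hv0, LinearPMap.map_zero, inner_zero_right, Complex.zero_re, zero_add]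
      exact mul_neg_of_pos_of_neg this hneg
    · exact add_neg_of_neg_of_nonpos (hV v hv hv0)
        (mul_nonpos_of_nonneg_of_nonpos (by positivity) hneg.le)
  have h1 := hle _ hW
  have hfr : Module.finrank ℂ ↥(V ⊔ Submodule.span ℂ {u}) ≤ Module.finrank ℂ V := by
    rw [← Module.finrank_eq_rank, ← Module.finrank_eq_rank, Cardinal.toENat_nat,
      Cardinal.toENat_nat] at h1
    exact_mod_cast h1
  have heq := Submodule.eq_of_le_of_finrank_le (le_sup_left : V ≤ V ⊔ Submodule.span ℂ {u}) hfr
  have huV : u ∈ V := heq ▸ Submodule.mem_sup_right (Submodule.mem_span_singleton_self u)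
  rw [hu u huV] at hneg
  exact lt_irrefl _ hneg

/-- A symmetric form with finite negative index is nonnegative on the kernel of finitely many
functionals, and its null vectors there are in the kernel of the operator. -/
theorem exists_functionals_of_negIndex_ne_top (hd : Dense (S.domain : Set X))
    (hS : ∀ u v : S.domain, ⟪S u, (v : X)⟫_ℂ = ⟪(u : X), S v⟫_ℂ) (hn : negIndex S ≠ ⊤) :
    ∃ (m : ℕ) (Φ : S.domain →ₗ[ℂ] (Fin m → ℂ)), ∀ u, Φ u = 0 →
      0 ≤ (⟪(u : X), S u⟫_ℂ).re ∧ ((⟪(u : X), S u⟫_ℂ).re = 0 → S u = 0) := by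
  obtain ⟨V, hfin, hV, hnn⟩ := exists_negative_submodule hS hn
  let e := Module.finBasis ℂ V
  let Φ : S.domain →ₗ[ℂ] (Fin (Module.finrank ℂ V) → ℂ) :=
    LinearMap.pi fun i => innerₛₗ ℂ ((e i : S.domain) : X) ∘ₗ S.toFun
  have hΦ : ∀ u, Φ u = 0 ↔ ∀ v ∈ V, ⟪(v : X), S u⟫_ℂ = 0 := fun u => by
    refine ⟨fun h v hv => ?_, fun h => funext fun i => h _ (e i).2⟩
    have hv' := congrArg (fun x : V => ((x : S.domain) : X)) (e.sum_repr ⟨v, hv⟩)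
    simp only [Submodule.coe_sum, Submodule.coe_smul] at hv'
    rw [← hv', sum_inner]
    refine Finset.sum_eq_zero fun i _ => ?_
    have hi : ⟪((e i : S.domain) : X), S u⟫_ℂ = 0 := congrFun h i
    rw [inner_smul_left, hi, mul_zero]
  -- The form is nondegenerate on `V`, so every `w` splits as an element of `V` plus an element of
  -- `ker Φ`.
  have hsurj : Function.Surjective (Φ ∘ₗ V.subtype) := by
    rw [← LinearMap.injective_iff_surjective_of_finrank_eq_finrank (by simp)]
    refine (injective_iff_map_eq_zero _).2 fun v hv => ?_
    by_contra hv0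
    have h1 := hV v v.2 (fun h => hv0 (Subtype.ext h))
    rw [(hΦ v).1 hv v v.2] at h1
    exact lt_irrefl _ h1
  refine ⟨_, Φ, fun u hu => ⟨hnn u ((hΦ u).1 hu), fun h0 => ?_⟩⟩
  refine hd.eq_zero_of_inner_right ℂ fun w hw => ?_
  lift w to S.domain using hw
  obtain ⟨v, hv⟩ := hsurj (Φ w)
  have hw' : Φ (w - v) = 0 := by rw [map_sub, ← hv]; simp
  set x := w - (v : S.domain) with hx
  -- The Cauchy–Schwarz argument for the nonnegative form on `ker Φ`: at `u - t β x` its value is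
  -- `(-2 t + t² q) ‖β‖²`, and `t = 1 / (q + 1)` makes it negative unless `β = 0`.
  have hxu : ⟪(x : X), S u⟫_ℂ = 0 := by
    by_contra hβ
    set β := ⟪(x : X), S u⟫_ℂ
    have hq := hnn x ((hΦ x).1 hw')
    set q := (⟪(x : X), S x⟫_ℂ).re
    set t : ℝ := 1 / (q + 1)
    have ht : 0 < t := by positivity
    have hcomb : Φ (u + (-(t : ℂ) * β) • x) = 0 := by rw [map_add, map_smul, hu, hw']; simp
    have h1 := hnn _ ((hΦ _).1 hcomb)
    rw [re_inner_map_add_smul hS, h0] at h1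
    have h2 : (star (-(t : ℂ) * β) * β).re = -t * ‖β‖ ^ 2 := by
      have : star (-(t : ℂ) * β) * β = ((-t * ‖β‖ ^ 2 : ℝ) : ℂ) := by
        have h3 := Complex.conj_mul' β
        push_cast
        rw [← h3]
        simp [mul_assoc]
      rw [this, Complex.ofReal_re]
    have h4 : ‖-(t : ℂ) * β‖ ^ 2 = t ^ 2 * ‖β‖ ^ 2 := by
      rw [norm_mul, norm_neg, Complex.norm_real, mul_pow, Real.norm_eq_abs, sq_abs]
    change 0 ≤ 0 + 2 * (star (-(t : ℂ) * β) * β).re + ‖-(t : ℂ) * β‖ ^ 2 * q at h1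
    rw [h2, h4] at h1
    have hb : 0 < ‖β‖ ^ 2 := by positivity
    have htq : t * q < 1 := by
      rw [div_mul_eq_mul_div, one_mul, div_lt_one (by positivity)]; linarith
    nlinarith [mul_pos ht hb]
  have hwx : (w : X) = x + ((v : S.domain) : X) := by simp [hx]
  rw [hwx, inner_add_left, hxu, (hΦ u).1 hu v v.2, add_zero]

end Index

/-! ### Existence of a point that is not an eigenvalue. -/

section Nondegenerate

variable {X : Type*} [NormedAddCommGroup X] [InnerProductSpace ℂ X] {A B C : X →ₗ.[ℂ] X}

/-- The vectors `u j`, scaled by the powers of distinct `r j`, are independent. -/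
theorem eq_zero_of_forall_sum_pow_smul_eq_zero {n : ℕ} {r : Fin n → ℂ}
    (hr : Function.Injective r) {u : Fin n → X} (h : ∀ k : ℕ, ∑ j, r j ^ k • u j = 0) (j : Fin n) :
    u j = 0 := by
  refine ext_inner_left ℂ fun x => ?_
  have := Matrix.eq_zero_of_forall_pow_sum_mul_pow_eq_zero hr (v := fun j => ⟪x, u j⟫_ℂ)
    fun k => by
      have := congrArg (fun y => ⟪x, y⟫_ℂ) (h k)
      simpa [inner_sum, inner_smul_right, mul_comm] using this
  simpa using congrFun this j

theorem exists_eigenvector {z : ℂ} (hz : z ∈ pencilEigenvalues A B C) :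
    ∃ u : pencilDomain A B C, u ≠ 0 ∧ pencilCoeff A B C z 0 u = 0 := by
  obtain ⟨x, hx, hx0⟩ := Submodule.exists_mem_ne_zero_of_ne_bot hz
  obtain ⟨h, h0⟩ := mem_kernel_iff.1 hx
  exact ⟨⟨x, h⟩, fun h' => hx0 (congrArg Subtype.val h'), h0⟩

/-- Eigenvectors for distinct positive eigenvalues span a neutral subspace of the form
`⟪u, A u⟫ + ⟪v, C v⟫`, in the variables `u` and `v = z u`. -/
theorem inner_add_mul_inner_eq_zero
    (hA : ∀ u v : A.domain, ⟪A u, (v : X)⟫_ℂ = ⟪(u : X), A v⟫_ℂ) (hB : IsSkewSymmetric B)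
    (hC : ∀ u v : C.domain, ⟪C u, (v : X)⟫_ℂ = ⟪(u : X), C v⟫_ℂ) {r s : ℝ} (hrs : r + s ≠ 0)
    {u v : pencilDomain A B C} (hu : pencilCoeff A B C r 0 u = 0)
    (hv : pencilCoeff A B C s 0 v = 0) :
    ⟪(u : X), A ⟨v, v.2.1.1⟩⟫_ℂ + r * s * ⟪(u : X), C ⟨v, v.2.2⟩⟫_ℂ = 0 := by
  have hu' : A ⟨u, u.2.1.1⟩ + (r : ℂ) • B ⟨u, u.2.1.2⟩ + (r : ℂ) ^ 2 • C ⟨u, u.2.2⟩ = 0 := hu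
  have hv' : A ⟨v, v.2.1.1⟩ + (s : ℂ) • B ⟨v, v.2.1.2⟩ + (s : ℂ) ^ 2 • C ⟨v, v.2.2⟩ = 0 := hv
  have h1 := congrArg (fun x => ⟪x, (v : X)⟫_ℂ) hu'
  have h2 := congrArg (fun x => ⟪(u : X), x⟫_ℂ) hv'
  have a1 := hA ⟨u, u.2.1.1⟩ ⟨v, v.2.1.1⟩
  have b1 := hB ⟨u, u.2.1.2⟩ ⟨v, v.2.1.2⟩
  have c1 := hC ⟨u, u.2.2⟩ ⟨v, v.2.2⟩
  simp only [inner_add_left, inner_add_right, inner_smul_left, inner_smul_right, map_pow,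
    Complex.conj_ofReal, inner_zero_left, inner_zero_right] at h1 h2 a1 b1 c1
  rw [a1, b1, c1] at h1
  have hrs' : (r : ℂ) + s ≠ 0 := by exact_mod_cast hrs
  refine mul_left_cancel₀ hrs' ?_
  -- The weights `s` and `r` cancel the skew term `⟪u, B v⟫`; what remains is the claim times `r +
  -- s`.
  linear_combination (s : ℂ) * h1 + (r : ℂ) * h2

theorem exists_notMem_pencilEigenvalues (hAd : Dense (A.domain : Set X))
    (hCd : Dense (C.domain : Set X))
    (hA : ∀ u v : A.domain, ⟪A u, (v : X)⟫_ℂ = ⟪(u : X), A v⟫_ℂ) (hB : IsSkewSymmetric B)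
    (hC : ∀ u v : C.domain, ⟪C u, (v : X)⟫_ℂ = ⟪(u : X), C v⟫_ℂ)
    [FiniteDimensional ℂ (kernel A)] (hnA : negIndex A ≠ ⊤) (hnC : negIndex C ≠ ⊤)
    (hkC : kernel C = ⊥) : ∃ z : ℂ, z ∉ pencilEigenvalues A B C := by
  by_contra! hall
  obtain ⟨m, Φ, hΦ⟩ := exists_functionals_of_negIndex_ne_top hAd hA hnA
  obtain ⟨n, Ψ, hΨ⟩ := exists_functionals_of_negIndex_ne_top hCd hC hnC
  -- One more than the number of linear conditions imposed on `c`: `m` for `A`, `n` for `C`, and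
  -- orthogonality to `ker A`.
  set N := m + (n + Module.finrank ℂ (kernel A)) + 1 with hN
  let r : Fin N → ℝ := fun j => (j : ℕ) + 1
  have hr : ∀ j, 0 < r j := fun j => by positivity
  have hrinj : Function.Injective fun j => (r j : ℂ) := fun i j h => by
    simpa [r, Fin.ext_iff] using h
  choose u hu0 hu using fun j : Fin N => exists_eigenvector (hall (r j))
  let L₀ : (Fin N → ℂ) →ₗ[ℂ] pencilDomain A B C := Fintype.linearCombination ℂ u
  let L₁ : (Fin N → ℂ) →ₗ[ℂ] pencilDomain A B C :=
    Fintype.linearCombination ℂ fun j => (r j : ℂ) • u j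
  let iA : pencilDomain A B C →ₗ[ℂ] A.domain := Submodule.inclusion (inf_le_left.trans inf_le_left)
  let iC : pencilDomain A B C →ₗ[ℂ] C.domain := Submodule.inclusion inf_le_right
  let F : (Fin N → ℂ) →ₗ[ℂ] (Fin m → ℂ) × (Fin n → ℂ) × kernel A :=
    (Φ ∘ₗ iA ∘ₗ L₀).prod ((Ψ ∘ₗ iC ∘ₗ L₁).prod
      ((kernel A).orthogonalProjectionOnto.toLinearMap ∘ₗ (pencilDomain A B C).subtype ∘ₗ L₀))
  have hF : LinearMap.ker F ≠ ⊥ := LinearMap.ker_ne_bot_of_finrank_lt (by simp [hN])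
  obtain ⟨c, hcF, hc0⟩ := Submodule.exists_mem_ne_zero_of_ne_bot hF
  obtain ⟨hF1, hF2, hF3⟩ : Φ (iA (L₀ c)) = 0 ∧ Ψ (iC (L₁ c)) = 0 ∧
      (kernel A).orthogonalProjectionOnto (L₀ c : X) = 0 := by
    simpa [F] using hcF
  have hneutral : ⟪((L₀ c : pencilDomain A B C) : X), A (iA (L₀ c))⟫_ℂ
      + ⟪((L₁ c : pencilDomain A B C) : X), C (iC (L₁ c))⟫_ℂ = 0 := by
    have e0 : L₀ c = ∑ j, c j • u j := Fintype.linearCombination_apply ..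
    have e1 : L₁ c = ∑ j, c j • (r j : ℂ) • u j := Fintype.linearCombination_apply ..
    have eA : A (iA (L₀ c)) = ∑ k, c k • A (iA (u k)) := by
      rw [e0, map_sum]
      change A.toFun _ = _
      rw [map_sum]
      exact Finset.sum_congr rfl fun k _ => by rw [map_smul, map_smul]; rfl
    have eC : C (iC (L₁ c)) = ∑ k, c k • (r k : ℂ) • C (iC (u k)) := by
      rw [e1, map_sum]
      change C.toFun _ = _
      rw [map_sum]
      exact Finset.sum_congr rfl fun k _ => by rw [map_smul, map_smul, map_smul, map_smul]; rfl
    rw [eA, eC, e0, e1]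
    simp only [Submodule.coe_sum, Submodule.coe_smul, sum_inner, inner_sum, inner_smul_left,
      inner_smul_right, Finset.mul_sum, ← Finset.sum_add_distrib]
    refine Finset.sum_eq_zero fun k _ => Finset.sum_eq_zero fun j _ => ?_
    have h := inner_add_mul_inner_eq_zero hA hB hC (add_pos (hr j) (hr k)).ne' (hu j) (hu k)
    change ⟪(u j : X), A (iA (u k))⟫_ℂ + r j * r k * ⟪(u j : X), C (iC (u k))⟫_ℂ = 0 at h
    simp only [Complex.conj_ofReal]
    linear_combination (c k * (starRingEnd ℂ) (c j)) * h
  obtain ⟨hA1, hA2⟩ := hΦ _ hF1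
  obtain ⟨hC1, hC2⟩ := hΨ _ hF2
  have hre := congrArg Complex.re hneutral
  rw [Complex.add_re, Complex.zero_re] at hre
  change 0 ≤ (⟪((L₀ c : pencilDomain A B C) : X), A (iA (L₀ c))⟫_ℂ).re at hA1
  change 0 ≤ (⟪((L₁ c : pencilDomain A B C) : X), C (iC (L₁ c))⟫_ℂ).re at hC1
  change (⟪((L₀ c : pencilDomain A B C) : X), A (iA (L₀ c))⟫_ℂ).re = 0 → _ at hA2
  change (⟪((L₁ c : pencilDomain A B C) : X), C (iC (L₁ c))⟫_ℂ).re = 0 → _ at hC2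
  have hCinj : ∀ y : C.domain, C y = 0 → y = 0 := fun y hy => by
    have : (y : X) ∈ kernel C := mem_kernel_iff.2 ⟨y.2, hy⟩
    rw [hkC] at this
    exact Subtype.ext ((Submodule.mem_bot ℂ).1 this)
  have h0 : L₀ c = 0 := by
    have hk : ((L₀ c : pencilDomain A B C) : X) ∈ kernel A :=
      mem_kernel_iff.2 ⟨_, hA2 (by linarith)⟩
    refine Subtype.ext ?_
    have := Submodule.starProjection_eq_self_iff.2 hk
    rw [← this, Submodule.starProjection_apply, hF3]
    rfl
  have h1 : L₁ c = 0 := by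
    have := hCinj _ (hC2 (by linarith))
    exact Subtype.ext (congrArg (fun y : C.domain => (y : X)) this)
  let w : ℕ → pencilDomain A B C := fun k => ∑ j, (r j : ℂ) ^ k • c j • u j
  have hw0 : w 0 = 0 := by
    rw [← h0]; simp [w, L₀, Fintype.linearCombination_apply]
  have hw1 : w 1 = 0 := by
    rw [← h1]
    simp only [w, L₁, Fintype.linearCombination_apply, pow_one]
    exact Finset.sum_congr rfl fun j _ => smul_comm ..
  -- Summing the eigenvalue equations gives `A (w k) + B (w (k + 1)) + C (w (k + 2)) = 0`, and `C`
  -- is injective. Thus all the power moments `w k` vanish, and the Vandermonde argument yields `c j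
  -- • u j = 0`.
  have hrec : ∀ k, w k = 0 → w (k + 1) = 0 → w (k + 2) = 0 := fun k hk hk1 => by
    let iB : pencilDomain A B C →ₗ[ℂ] B.domain :=
      Submodule.inclusion (inf_le_left.trans inf_le_right)
    have hsum : A.toFun (iA (w k)) + B.toFun (iB (w (k + 1))) + C.toFun (iC (w (k + 2))) = 0 := by
      simp only [w, map_sum, map_smul, ← Finset.sum_add_distrib]
      refine Finset.sum_eq_zero fun j _ => ?_
      have h : A.toFun (iA (u j)) + (r j : ℂ) • B.toFun (iB (u j))
        + (r j : ℂ) ^ 2 • C.toFun (iC (u j)) = 0 := hu j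
      linear_combination (norm := module) ((r j : ℂ) ^ k * c j) • h
    rw [hk, hk1, map_zero, map_zero, map_zero, map_zero, zero_add, zero_add] at hsum
    exact Subtype.ext (congrArg (fun y : C.domain => (y : X)) (hCinj _ hsum))
  have hw : ∀ k, w k = 0 ∧ w (k + 1) = 0 := fun k => by
    induction k with
    | zero => exact ⟨hw0, hw1⟩
    | succ k ih => exact ⟨ih.2, hrec k ih.1 ih.2⟩
  refine hc0 (funext fun j => ?_)
  have hj := eq_zero_of_forall_sum_pow_smul_eq_zero hrinj (u := fun j => (c j • u j : X))
    (fun k => by simpa [w] using congrArg Subtype.val (hw k).1) j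
  rcases smul_eq_zero.1 hj with h | h
  · exact h
  · exact absurd (Subtype.ext h) (hu0 j)

end Nondegenerate

/-! ### Jordan chains as polynomial germs. -/

section Chains

variable {X : Type*} [NormedAddCommGroup X] [NormedSpace ℂ X]

/-- The coefficients of `t ^ i` with `i < k + 2` are the left sides of the Jordan chain equations,
so for a chain only the multiple of `t ^ (k + 2)` survives. -/
theorem quadratic_apply_sum_range (G₀ G₁ G₂ : X →L[ℂ] X) (x : ℕ → X) (t : ℂ) (k : ℕ) :
    (G₀ + t • G₁ + t ^ 2 • G₂) (∑ i ∈ Finset.range (k + 2), t ^ i • x i) =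
      G₀ (x 0) + t • (G₀ (x 1) + G₁ (x 0))
      + ∑ i ∈ Finset.range k, t ^ (i + 2) • (G₀ (x (i + 2)) + G₁ (x (i + 1)) + G₂ (x i))
      + t ^ (k + 2) • (G₁ (x (k + 1)) + G₂ (x k) + t • G₂ (x (k + 1))) := by
  induction k with
  | zero =>
    simp only [add_apply, smul_apply, Finset.sum_range_succ, Finset.sum_range_zero, map_add,
      map_smul, map_zero]
    module
  | succ k ih =>
    rw [Finset.sum_range_succ, map_add, ih, Finset.sum_range_succ]
    simp only [add_apply, smul_apply, map_smul]
    module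

end Chains

/-! ### The bounded model and the spectral conclusions. -/

section Model

variable {X : Type*} [NormedAddCommGroup X] [InnerProductSpace ℂ X] {A B C : X →ₗ.[ℂ] X}

/-- A pencil is modelled by bounded operators if a bounded injective map `E` onto its domain turns
its coefficients into `1 + K₀`, `K₁` and `K₂` with compact `K₀`, `K₁` and `K₂`. -/
structure IsCompactModel (A B C : X →ₗ.[ℂ] X) (E K₀ K₁ K₂ : X →L[ℂ] X) : Prop where
  compact₀ : IsCompactOperator K₀
  compact₁ : IsCompactOperator K₁
  compact₂ : IsCompactOperator K₂
  mem : ∀ x, E x ∈ pencilDomain A B C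
  surj : ∀ u : pencilDomain A B C, ∃ x, E x = u
  inj : ∀ x, E x = 0 → x = 0
  map₀ : ∀ x, A ⟨E x, (mem x).1.1⟩ = (1 + K₀) x
  map₁ : ∀ x, B ⟨E x, (mem x).1.2⟩ = K₁ x
  map₂ : ∀ x, C ⟨E x, (mem x).2⟩ = K₂ x

/-- The compact part of the bounded pencil which models a quadratic pencil. -/
def compactPencil (K₀ K₁ K₂ : X →L[ℂ] X) (z : ℂ) : X →L[ℂ] X := K₀ + z • K₁ + z ^ 2 • K₂

theorem differentiable_compactPencil (K₀ K₁ K₂ : X →L[ℂ] X) :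
    Differentiable ℂ (compactPencil K₀ K₁ K₂) := by
  unfold compactPencil; fun_prop

theorem one_add_compactPencil_add (K₀ K₁ K₂ : X →L[ℂ] X) (z t : ℂ) :
    1 + compactPencil K₀ K₁ K₂ (z + t)
      = (1 + compactPencil K₀ K₁ K₂ z) + t • (K₁ + (2 * z) • K₂) + t ^ 2 • K₂ := by
  unfold compactPencil; module

namespace IsCompactModel

variable {E K₀ K₁ K₂ : X →L[ℂ] X} (h : IsCompactModel A B C E K₀ K₁ K₂)
include h

theorem isCompactOperator (z : ℂ) : IsCompactOperator (compactPencil K₀ K₁ K₂ z) :=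
  (h.compact₀.add (h.compact₁.smul z)).add (h.compact₂.smul (z ^ 2))

theorem coeff_zero (z : ℂ) (x : X) :
    pencilCoeff A B C z 0 ⟨E x, h.mem x⟩ = (1 + compactPencil K₀ K₁ K₂ z) x := by
  change A ⟨E x, (h.mem x).1.1⟩ + z • B ⟨E x, (h.mem x).1.2⟩ + z ^ 2 • C ⟨E x, (h.mem x).2⟩ = _
  rw [h.map₀, h.map₁, h.map₂]
  simp [compactPencil, add_assoc]

theorem coeff_one (z : ℂ) (x : X) :
    pencilCoeff A B C z 1 ⟨E x, h.mem x⟩ = (K₁ + (2 * z) • K₂) x := by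
  change B ⟨E x, (h.mem x).1.2⟩ + (2 * z) • C ⟨E x, (h.mem x).2⟩ = _
  rw [h.map₁, h.map₂]
  rfl

theorem coeff_two (z : ℂ) (x : X) : pencilCoeff A B C z 2 ⟨E x, h.mem x⟩ = K₂ x :=
  h.map₂ x

theorem exists_eq (u : pencilDomain A B C) : ∃ x, u = ⟨E x, h.mem x⟩ := by
  obtain ⟨x, hx⟩ := h.surj u
  exact ⟨x, Subtype.ext hx.symm⟩

theorem mem_pencilEigenvalues_iff (z : ℂ) :
    z ∈ pencilEigenvalues A B C ↔ ∃ x ≠ 0, (1 + compactPencil K₀ K₁ K₂ z) x = 0 := by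
  constructor
  · intro hz
    obtain ⟨u, hu0, hu⟩ := exists_eigenvector hz
    obtain ⟨x, rfl⟩ := h.exists_eq u
    refine ⟨x, ?_, by rw [← h.coeff_zero, hu]⟩
    rintro rfl
    exact hu0 (Subtype.ext (map_zero E))
  · rintro ⟨x, hx0, hx⟩ hker
    have : E x ∈ kernel (pencil A B C z) :=
      mem_kernel_iff.2 ⟨h.mem x, (h.coeff_zero z x).trans hx⟩
    rw [hker, Submodule.mem_bot] at this
    exact hx0 (h.inj x this)

/-- Off the eigenvalues `1 + K z` is injective, hence invertible, and `E (1 + K z)⁻¹` inverts the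
pencil. Conversely, a left inverse excludes a kernel. -/
theorem pencilSpectrum_eq [CompleteSpace X] :
    pencilSpectrum A B C = pencilEigenvalues A B C := by
  ext z
  constructor
  · intro hz
    by_contra hne
    rw [h.mem_pencilEigenvalues_iff] at hne
    push Not at hne
    obtain ⟨U, hU⟩ := isUnit_one_add_of_injective (h.isCompactOperator z)
      fun x hx => by_contra fun h0 => hne x h0 hx
    have hinv : ∀ x, (↑U⁻¹ : X →L[ℂ] X) ((1 + compactPencil K₀ K₁ K₂ z) x) = x := fun x => by
      rw [← hU, ← mul_apply_eq_comp, Units.inv_mul]; rfl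
    have hinv' : ∀ x, (1 + compactPencil K₀ K₁ K₂ z) ((↑U⁻¹ : X →L[ℂ] X) x) = x := fun x => by
      rw [← hU, ← mul_apply_eq_comp, Units.mul_inv]; rfl
    refine hz ⟨E * (↑U⁻¹ : X →L[ℂ] X), fun u => ?_, fun v => ?_⟩
    · obtain ⟨x, hx⟩ := h.exists_eq u
      have hPu : pencil A B C z u = (1 + compactPencil K₀ K₁ K₂ z) x := by
        rw [hx]; exact h.coeff_zero z x
      rw [hPu, mul_apply_eq_comp, hinv, hx]
    · exact ⟨⟨E ((↑U⁻¹ : X →L[ℂ] X) v), h.mem _⟩, rfl, (h.coeff_zero z _).trans (hinv' v)⟩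
  · rintro hz ⟨S, hS, -⟩
    obtain ⟨u, hu0, hu⟩ := exists_eigenvector hz
    refine hu0 (Subtype.ext ?_)
    have h1 : pencil A B C z u = 0 := hu
    have h2 := hS u
    rw [h1, map_zero] at h2
    exact h2.symm

theorem not_accPt [CompleteSpace X] (hne : ∃ z, z ∉ pencilEigenvalues A B C) (z : ℂ) :
    ¬ AccPt z (𝓟 (pencilEigenvalues A B C)) :=
  not_accPt_noninjective (differentiable_compactPencil K₀ K₁ K₂) h.isCompactOperator
    h.mem_pencilEigenvalues_iff (fun hu => by
      obtain ⟨w, hw⟩ := hne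
      exact hw (hu ▸ Set.mem_univ w)) z

/-- The first vector of a chain is an eigenvector or zero, so it lies in the image under `E` of the
finite-dimensional kernel of `1 + K z`. -/
theorem finiteDimensional_leadingVectors (z : ℂ) (k : ℕ) :
    FiniteDimensional ℂ (leadingVectors A B C z (k + 1)) := by
  have := finiteDimensional_ker_one_add (h.isCompactOperator z)
  let f : X →ₗ[ℂ] pencilDomain A B C := E.toLinearMap.codRestrict _ h.mem
  have hle : leadingVectors A B C z (k + 1)
      ≤ (LinearMap.ker (1 + compactPencil K₀ K₁ K₂ z).toLinearMap).map f := by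
    rintro _ ⟨u, rfl, hu⟩
    obtain ⟨x, hx⟩ := h.exists_eq (u 0)
    refine ⟨x, ?_, hx.symm⟩
    have := hu 0 k.succ_pos
    simp only [zero_add, Finset.sum_range_one, Nat.sub_zero] at this
    rw [hx, h.coeff_zero] at this
    exact this
  exact Submodule.finiteDimensional_of_le hle

theorem exists_leadingVectors_eq_bot [CompleteSpace X]
    (hne : ∃ z, z ∉ pencilEigenvalues A B C) (z : ℂ) :
    ∃ N : ℕ, ∀ k, N ≤ k → leadingVectors A B C z k = ⊥ := by
  have hfreq : ∃ᶠ w in 𝓝 z, ∀ x, (1 + compactPencil K₀ K₁ K₂ w) x = 0 → x = 0 := by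
    have hacc := h.not_accPt hne z
    rw [accPt_iff_frequently_nhdsNE] at hacc
    have hev : ∀ᶠ w in 𝓝[≠] z, ¬ w ∈ pencilEigenvalues A B C := not_frequently.1 hacc
    refine hev.frequently.filter_mono nhdsWithin_le_nhds |>.mono fun w hw x hx => ?_
    by_contra h0
    exact hw ((h.mem_pencilEigenvalues_iff w).2 ⟨x, h0, hx⟩)
  obtain ⟨m, hm⟩ := exists_order_bound (differentiable_compactPencil K₀ K₁ K₂)
    h.isCompactOperator hfreq
  -- Length `m + 1` would already suffice; `m + 2` guarantees the two leading terms in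
  -- `quadratic_apply_sum_range`.
  refine ⟨m + 2, fun k hk => (Submodule.eq_bot_iff _).2 ?_⟩
  obtain ⟨l, rfl⟩ := Nat.exists_eq_add_of_le' hk
  rintro _ ⟨u, rfl, hu⟩
  choose x hx using fun i => h.exists_eq (u i)
  simp only [hx] at hu ⊢
  set G₀ := 1 + compactPencil K₀ K₁ K₂ z with hG₀
  set G₁ := K₁ + (2 * z) • K₂ with hG₁
  have e0 : G₀ (x 0) = 0 := by
    have := hu 0 (by omega)
    simp only [zero_add, Finset.sum_range_one, Nat.sub_zero] at this
    rwa [h.coeff_zero] at this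
  have e1 : G₀ (x 1) + G₁ (x 0) = 0 := by
    have := hu 1 (by omega)
    simp only [Finset.sum_range_succ, Finset.sum_range_zero, zero_add, Nat.sub_zero,
      Nat.sub_self] at this
    rwa [h.coeff_zero, h.coeff_one] at this
  have e2 : ∀ i ∈ Finset.range (l + m), G₀ (x (i + 2)) + G₁ (x (i + 1)) + K₂ (x i) = 0 := by
    intro i hi
    have hi' := Finset.mem_range.1 hi
    have := hu (i + 2) (by omega)
    -- The terms `j = 0, 1, 2` are split off; the Taylor coefficients with `j ≥ 3` are zero.
    rw [Finset.sum_range_succ', Finset.sum_range_succ', Finset.sum_range_succ',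
      Finset.sum_eq_zero (fun j _ => by rfl), zero_add] at this
    simp only [zero_add, Nat.sub_zero, Nat.reduceAdd] at this
    rw [h.coeff_zero, h.coeff_one, h.coeff_two, Nat.add_sub_cancel,
      show i + 2 - 1 = i + 1 by omega] at this
    rw [← this]
    abel
  -- The polynomial `∑ t ^ i • x i` built from the chain is annihilated to order `l + m + 2 ≥ m +
  -- 1`, so its value `x 0` at `t = 0` vanishes.
  have hx0 := hm (fun t => ∑ i ∈ Finset.range (l + m + 2), t ^ i • x i)
    (fun t => t ^ (l + 1) • (G₁ (x (l + m + 1)) + K₂ (x (l + m)) + t • K₂ (x (l + m + 1))))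
    (by fun_prop) (by fun_prop) fun t => by
      rw [one_add_compactPencil_add, quadratic_apply_sum_range, e0, e1,
        Finset.sum_eq_zero fun i hi => by rw [e2 i hi, smul_zero], smul_smul, ← pow_add]
      simp only [smul_zero, add_zero, zero_add]
      congr 2
      omega
  have hsum : ∑ i ∈ Finset.range (l + m + 2), (0 : ℂ) ^ i • x i = x 0 := by
    rw [Finset.sum_range_succ', Finset.sum_eq_zero fun i _ => by simp]
    simp
  rw [hsum] at hx0
  exact Subtype.ext (by rw [hx0]; exact map_zero E)

theorem algMultiplicity_lt_top [CompleteSpace X]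
    (hne : ∃ z, z ∉ pencilEigenvalues A B C) (z : ℂ) : algMultiplicity A B C z < ⊤ := by
  obtain ⟨N, hN⟩ := h.exists_leadingVectors_eq_bot hne z
  set f : ℕ → ℕ∞ := fun k => Cardinal.toENat (Module.rank ℂ (leadingVectors A B C z (k + 1)))
  have hf : ∀ k, f k < ⊤ := fun k => by
    have := h.finiteDimensional_leadingVectors z k
    rw [lt_top_iff_ne_top, Ne, Cardinal.toENat_eq_top, not_le]
    exact Module.rank_lt_aleph0 ℂ _
  have hf0 : ∀ k, f (N + k) = 0 := fun k => by
    simp [f, hN (N + k + 1) (by omega)]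
  refine lt_of_le_of_lt (b := ∑ k ∈ Finset.range N, f k) (iSup_le fun n => ?_)
    (WithTop.sum_lt_top.2 fun k _ => hf k)
  calc ∑ k ∈ Finset.range n, f k ≤ ∑ k ∈ Finset.range (N + n), f k :=
        Finset.sum_le_sum_of_subset (Finset.range_mono (by omega))
    _ = ∑ k ∈ Finset.range N, f k := by
        rw [Finset.sum_range_add, Finset.sum_eq_zero fun k _ => hf0 k, add_zero]

end IsCompactModel

theorem exists_isCompactModel [CompleteSpace X] (hA : IsSelfAdjoint A) (hB : IsSkewSymmetric B)
    (hC : IsSelfAdjoint C) (hAB : A.domain ≤ B.domain) (hAC : A.domain ≤ C.domain)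
    [FiniteDimensional ℂ (kernel A)] {R : (kernel A)ᗮ →L[ℂ] (kernel A)ᗮ}
    (hR : IsBoundedInverse (compression A (kernel A)ᗮ) R)
    (hRB : IsCompactOp (R.toLinearMap.compPMap (compression B (kernel A)ᗮ)))
    (hRC : IsCompactOp (R.toLinearMap.compPMap (compression C (kernel A)ᗮ))) :
    ∃ E K₀ K₁ K₂ : X →L[ℂ] X, IsCompactModel A B C E K₀ K₁ K₂ := by
  have hAs := inner_map_eq_of_isSelfAdjoint hA
  obtain ⟨K₁, hK₁, h₁⟩ := exists_compact_comp_domainParam hA.dense_domain hAs hR (σ := -1)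
    (by norm_num) (fun u v => by rw [hB u v, neg_one_mul]) hAB hRB
  obtain ⟨K₂, hK₂, h₂⟩ := exists_compact_comp_domainParam hA.dense_domain hAs hR (σ := 1)
    (by norm_num) (fun u v => by rw [inner_map_eq_of_isSelfAdjoint hC u v, one_mul]) hAC hRC
  have hmem := domainParam_mem hAs hR
  have : ProperSpace (kernel A) := FiniteDimensional.proper ℂ _
  -- Here `A E = 1 - Q`, so `K₀ = -Q`, which has finite rank.
  refine ⟨domainParam (kernel A) R, -(kernel A).starProjection, K₁, K₂, ?_, hK₁, hK₂,
    fun x => ⟨⟨hmem x, hAB (hmem x)⟩, hAC (hmem x)⟩,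
    fun u => exists_domainParam_eq hAs hR u.2.1.1, fun x => domainParam_eq_zero hAs hR, fun x => ?_,
    fun x => (h₁ x _).symm, fun x => (h₂ x _).symm⟩
  · exact ((isCompactOperator_of_locallyCompactSpace_rng (kernel A).subtypeL).comp_clm
      (kernel A).orthogonalProjectionOnto).neg
  · rw [map_domainParam hAs hR]
    simp [sub_eq_add_neg]

end Model

end QuadPencil

theorem lemma2p1 {X : Type*} [NormedAddCommGroup X] [InnerProductSpace ℂ X] [CompleteSpace X]
    (A B C : X →ₗ.[ℂ] X)
    (hA : IsSelfAdjoint A) (hB : QuadPencil.IsSkewSymmetric B) (hC : IsSelfAdjoint C)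
    (hAB : A.domain ≤ B.domain) (hAC : A.domain ≤ C.domain)
    (hker : FiniteDimensional ℂ (QuadPencil.kernel A))
    (hnd : (QuadPencil.negIndex A ≠ ⊤ ∧ QuadPencil.negIndex C ≠ ⊤ ∧ QuadPencil.kernel C = ⊥) ∨
      ∃ z : ℂ, z ∉ QuadPencil.pencilEigenvalues A B C)
    (R : (QuadPencil.kernel A)ᗮ →L[ℂ] (QuadPencil.kernel A)ᗮ)
    (hR : QuadPencil.IsBoundedInverse (QuadPencil.compression A (QuadPencil.kernel A)ᗮ) R)
    (hRB : QuadPencil.IsCompactOp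
      (R.toLinearMap.compPMap (QuadPencil.compression B (QuadPencil.kernel A)ᗮ)))
    (hRC : QuadPencil.IsCompactOp
      (R.toLinearMap.compPMap (QuadPencil.compression C (QuadPencil.kernel A)ᗮ))) :
    QuadPencil.pencilSpectrum A B C = QuadPencil.pencilEigenvalues A B C ∧
    (∀ z ∈ QuadPencil.pencilEigenvalues A B C, QuadPencil.algMultiplicity A B C z < ⊤) ∧
    ∀ z : ℂ, ¬ AccPt z (Filter.principal (QuadPencil.pencilEigenvalues A B C)) := by
  have hne : ∃ z : ℂ, z ∉ QuadPencil.pencilEigenvalues A B C := by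
    rcases hnd with ⟨hnA, hnC, hkC⟩ | h
    · exact QuadPencil.exists_notMem_pencilEigenvalues hA.dense_domain hC.dense_domain
        (QuadPencil.inner_map_eq_of_isSelfAdjoint hA) hB
        (QuadPencil.inner_map_eq_of_isSelfAdjoint hC) hnA hnC hkC
    · exact h
  obtain ⟨E, K₀, K₁, K₂, h⟩ := QuadPencil.exists_isCompactModel hA hB hC hAB hAC hR hRB hRC
  exact ⟨h.pencilSpectrum_eq, fun z _ => h.algMultiplicity_lt_top hne z, h.not_accPt hne⟩
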